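/- Let $p$ be a prime, $q$ a power of $p$, $\mathbb{A}=\mathbb{F}_q[T]$, and let $\mathbb{A}_+$ be the set of monic polynomials in $\mathbb{A}$. For $0\ne G\in\mathbb{A}$ put $|G|=q^{\deg G}$; let $\mu(G)=0$ if $G$ is not squarefree and $\mu(G)=(-1)^t$ if $G$ is a constant times a product of $t$ distinct monic irreducible polynomials. For $s\in\mathbb{R}$ and $0\ne G\in\mathbb{A}$ let $\phi_s(G)=\sum_{D\mid G}\mu(G/D)\,|D|^s$, the sum running over the monic divisors $D$ of $G$, and let $\phi(G)$ be Euler's totient, the number of residue classes modulo $G$ that are coprime to $G$. Let $\zeta_{\mathbb{A}}(s)=\sum_{f\in\mathbb{A}_+}|f|^{-s}$ for real $s>1$. For $G\in\mathbb{A}$ and $H\in\mathbb{A}_+$ of degree $m$ define the polynomial Ramanujan sum $$\eta(G,H)=\sum_{\substack{D \bmod H\\ (D,H)=1}}\exp\!\left(\frac{2\pi i\,\mathrm{tr}(t_H(GD))}{p}\right),$$ where $t_H(A)$ is the coefficient of $T^{m-1}$ in the remainder of $A$ modulo $H$ (and $t_H(A)=0$ if $m=0$), and $\mathrm{tr}:\mathbb{F}_q\to\mathbb{F}_p$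 is the trace. Let $k\ge 1$ be an integer and $G_1,\dots,G_k\in\mathbb{A}_+$. Write $(G_1,\dots,G_k)$ for their monic greatest common divisor and, for $H_1,\dots,H_k\in\mathbb{A}_+$, write $Q=[H_1,\dots,H_k]$ for their monic least common multiple. Then for every $s\in\mathbb{R}$ with $k+s>1$, $$\frac{\phi_s((G_1,\dots,G_k))}{|(G_1,\dots,G_k)|^s}=\frac{1}{\zeta_{\mathbb{A}}(k+s)}\sum_{H_1,\dots,H_k\in\mathbb{A}_+}\frac{\mu(Q)\,\eta(G_1,H_1)\cdots\eta(G_k,H_k)}{\phi_{k+s}(Q)},$$ and $$\frac{\phi((G_1,\dots,G_k))}{|(G_1,\dots,G_k)|}=\frac{1}{\zeta_{\mathbb{A}}(k+1)}\sum_{H_1,\dots,H_k\in\mathbb{A}_+}\frac{\mu(Q)\,\eta(G_1,H_1)\cdots\eta(G_k,H_k)}{\phi_{k+1}(Q)},$$ where both series converge absolutely. -/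

import Mathlib

open Polynomial

/-- Normalized gcd structure on `F[X]`: gcds and lcms of nonzero polynomials are monic. -/
noncomputable abbrev polyNormalizedGCDMonoid (F : Type*) [Field F] :
    NormalizedGCDMonoid F[X] :=
  letI : DecidableEq F := Classical.decEq F
  UniqueFactorizationMonoid.toNormalizedGCDMonoid F[X]

namespace PolyRamanujan

/-- The set `𝔸₊` of monic polynomials over `F`, as a type. -/
abbrev MonicPoly (F : Type*) [Field F] : Type _ := {f : F[X] // f.Monic}

/-- The absolute value `|G| = q ^ deg G`, where `q` is the number of elements of `F`
(only used for `G ≠ 0`). -/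
noncomputable def absv {F : Type*} [Field F] (G : F[X]) : ℝ :=
  (Nat.card F : ℝ) ^ G.natDegree

open Classical in
/-- The Möbius function on `F[X]`: `0` if `G` is not squarefree, and `(-1) ^ t` if `G` is a
constant times a product of `t` distinct monic irreducible polynomials. -/
noncomputable def moebius {F : Type*} [Field F] (G : F[X]) : ℤ :=
  if Squarefree G then (-1) ^ (UniqueFactorizationMonoid.factors G).card else 0

/-- The set of monic divisors of `G`. -/
def monicDivisors {F : Type*} [Field F] (G : F[X]) : Set F[X] :=
  {D | D.Monic ∧ D ∣ G}

/-- The set of residues modulo `H` (`H ≠ 0`) coprime to `H`, represented by the polynomials of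
degree smaller than `deg H`. For constant `H ≠ 0` this is `{0}`. -/
def reducedResidues {F : Type*} [Field F] (H : F[X]) : Set F[X] :=
  {D | D.degree < H.degree ∧ IsCoprime D H}

/-- There are finitely many polynomials of degree less than `n` over a finite field. -/
theorem finite_degree_lt (F : Type*) [Field F] [Finite F] (H : F[X]) :
    {D : F[X] | D.degree < H.degree}.Finite := by
  have hfin : Finite (degreeLT F H.natDegree) :=
    Finite.of_equiv _ (degreeLTEquiv F H.natDegree).symm.toEquiv
  refine (Set.toFinite ((degreeLT F H.natDegree : Set F[X]))).subset ?_
  intro D hD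
  exact mem_degreeLT.2 (lt_of_lt_of_le hD degree_le_natDegree)

theorem finite_reducedResidues {F : Type*} [Field F] [Finite F] (H : F[X]) :
    (reducedResidues H).Finite :=
  (finite_degree_lt F H).subset fun _ hD => hD.1

theorem finite_monicDivisors {F : Type*} [Field F] [Finite F] {G : F[X]} (hG : G ≠ 0) :
    (monicDivisors G).Finite := by
  refine (finite_degree_lt F (X * G)).subset ?_
  intro D hD
  refine lt_of_le_of_lt (degree_le_of_dvd hD.2 hG) ?_
  rw [degree_mul, degree_X, degree_eq_natDegree hG]
  exact_mod_cast (by omega : G.natDegree < 1 + G.natDegree)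

/-- The Jordan totient function `φ_s(G) = ∑_{D ∣ G} μ(G / D) |D| ^ s`, the sum being over the
(finitely many) monic divisors of `G ≠ 0`. -/
noncomputable def jordan {F : Type*} [Field F] (s : ℝ) (G : F[X]) : ℝ :=
  ∑ᶠ D ∈ monicDivisors G, (moebius (G / D) : ℝ) * absv D ^ s

/-- Euler's totient function on `F[X]`: the number of reduced residues modulo `G`. -/
noncomputable def totient {F : Type*} [Field F] (G : F[X]) : ℕ :=
  (reducedResidues G).ncard

/-- The zeta function `ζ_𝔸(s) = ∑_{f ∈ 𝔸₊} |f| ^ (-s)` of `𝔸 = F[X]`, for real `s`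
(convergent for `s > 1`). -/
noncomputable def zetaA (F : Type*) [Field F] (s : ℝ) : ℝ :=
  ∑' f : MonicPoly F, 1 / absv f.1 ^ s

/-- The additive character `λ(a) = exp(2πi tr(a) / p)` of `F`, with `tr` the trace to `𝔽_p`. -/
noncomputable def baseChar {F : Type*} [Field F] (p : ℕ) [Fact p.Prime] [Algebra (ZMod p) F]
    (a : F) : ℂ :=
  Complex.exp (2 * Real.pi * Complex.I * (((Algebra.trace (ZMod p) F a).val : ℂ) / (p : ℂ)))

/-- The additive function `t` modulo `H ≠ 0`: the coefficient of `T ^ (m - 1)` in the remainder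
of `A` modulo `H`, where `m = deg H`. If `m = 0`, the remainder and hence the value is `0`. -/
noncomputable def tCoeff {F : Type*} [Field F] (H A : F[X]) : F :=
  (A % H).coeff (H.natDegree - 1)

/-- The character `E(G, H)(A) = λ(t(G A))` modulo `H`. -/
noncomputable def charE {F : Type*} [Field F] (p : ℕ) [Fact p.Prime] [Algebra (ZMod p) F]
    (G H A : F[X]) : ℂ :=
  baseChar p (tCoeff H (G * A))

/-- The polynomial Ramanujan sum `η(G, H) = ∑_{D mod H, (D, H) = 1} E(G, H)(D)`, `H ≠ 0`. -/
noncomputable def ramanujanSum {F : Type*} [Field F] (p : ℕ) [Fact p.Prime]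
    [Algebra (ZMod p) F] (G H : F[X]) : ℂ :=
  ∑ᶠ D ∈ reducedResidues H, charE p G H D

/-- The monic greatest common divisor of `G_1, …, G_k`. -/
noncomputable def gcdFam {F : Type*} [Field F] {k : ℕ} (G : Fin k → MonicPoly F) : F[X] :=
  letI := polyNormalizedGCDMonoid F
  Finset.univ.gcd fun i => (G i).1

/-- The monic least common multiple of `H_1, …, H_k`. -/
noncomputable def lcmFam {F : Type*} [Field F] {k : ℕ} (H : Fin k → MonicPoly F) : F[X] :=
  letI := polyNormalizedGCDMonoid F
  Finset.univ.lcm fun i => (H i).1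

/-- The term `μ(Q) η(G_1, H_1) ⋯ η(G_k, H_k) / φ_r(Q)`, with `Q = [H_1, …, H_k]`. -/
noncomputable def expansionTerm {F : Type*} [Field F] (p : ℕ) [Fact p.Prime]
    [Algebra (ZMod p) F] {k : ℕ} (r : ℝ) (G H : Fin k → MonicPoly F) : ℂ :=
  (moebius (lcmFam H) : ℂ) * (∏ i, ramanujanSum p (G i).1 (H i).1) /
    (jordan r (lcmFam H) : ℂ)

end PolyRamanujan

/-! Write `r = k + s`, let `D` be the gcd of the `G_i`, and evaluate in two ways the double series
of `μ(E) |E|^(-r) ∏ η(G_i, H_i)` over monic `E` and monic `H_i ∣ E`.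

For fixed `E` the sum over the `H_i` is a product of divisor sums. Sorting the residues mod `E` by
their gcd with `E`, and using orthogonality of characters, `∑_{H ∣ E} η(G, H)` is `|E|` if `E ∣ G`
and `0` otherwise (`sum_divs_ramanujanSum`). Only `E ∣ D` survive, and what remains is `∑_{E ∣ D}
μ(E) |E|^(-s) = φ_s(D) / |D|^s` (`jordan_mul_weight`).

For fixed `H_i` with lcm `Q`, the sum of `μ(E) |E|^(-r)` over multiples `E` of `Q` is `μ(Q) / (ζ(r)
φ_r(Q))` (`tsum_multiples_moebius`), which gives the required term.

The exchange is legitimate because `|η(G, H)|` is bounded independently of `H`, so the double series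
is dominated by a multiple of `∑ d(E)^k |E|^(-r)`, where `d(E)` counts monic divisors
(`summable_norm_doubleTerm`). -/

namespace PolyRamanujan

/-! ### Divisibility, gcd and lcm of monic polynomials. -/

section MonicMonoid

variable {F : Type*} [Field F]

noncomputable instance : Mul (MonicPoly F) := ⟨fun A B => ⟨A.1 * B.1, A.2.mul B.2⟩⟩
noncomputable instance : One (MonicPoly F) := ⟨⟨1, monic_one⟩⟩
noncomputable instance : Pow (MonicPoly F) ℕ := ⟨fun A n => ⟨A.1 ^ n, A.2.pow n⟩⟩

/-- Monic polynomials form a commutative monoid under multiplication. -/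
noncomputable instance : CommMonoid (MonicPoly F) :=
  Function.Injective.commMonoid (fun A : MonicPoly F => A.1) Subtype.val_injective rfl
    (fun _ _ => rfl) fun _ _ => rfl

@[simp] theorem MonicPoly.coe_mul (A B : MonicPoly F) : (A * B).1 = A.1 * B.1 := rfl

@[simp] theorem MonicPoly.coe_one : (1 : MonicPoly F).1 = 1 := rfl

theorem MonicPoly.ne_zero (A : MonicPoly F) : A.1 ≠ 0 := A.2.ne_zero

theorem MonicPoly.mul_left_cancel' {A B C : MonicPoly F} (h : A * B = A * C) : B = C :=
  Subtype.ext (_root_.mul_left_cancel₀ A.ne_zero (congrArg Subtype.val h))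

theorem MonicPoly.dvd_iff {A B : MonicPoly F} : A ∣ B ↔ A.1 ∣ B.1 := by
  constructor
  · rintro ⟨C, rfl⟩
    exact ⟨C.1, rfl⟩
  · rintro ⟨C, hC⟩
    exact ⟨⟨C, Monic.of_mul_monic_left A.2 (hC ▸ B.2)⟩, Subtype.ext hC⟩

theorem MonicPoly.eq_one_iff_isUnit {A : MonicPoly F} : A = 1 ↔ IsUnit A.1 := by
  rw [A.2.isUnit_iff, ← MonicPoly.coe_one, Subtype.ext_iff]

/-- Existence of the monic gcd of a polynomial and a monic polynomial. -/
theorem MonicPoly.exists_gcd_of_polynomial (A : F[X]) (B : MonicPoly F) :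
    ∃ D : MonicPoly F, D.1 ∣ A ∧ D ∣ B ∧ ∀ C : F[X], C ∣ A → C ∣ B.1 → C ∣ D.1 := by
  classical
  refine ⟨⟨normalize (EuclideanDomain.gcd A B.1), monic_normalize ?_⟩, ?_, ?_, ?_⟩
  · intro h
    exact B.ne_zero (EuclideanDomain.gcd_eq_zero_iff.1 h).2
  · exact (normalize_dvd_iff).2 (EuclideanDomain.gcd_dvd_left _ _)
  · exact MonicPoly.dvd_iff.2 ((normalize_dvd_iff).2 (EuclideanDomain.gcd_dvd_right _ _))
  · exact fun C h1 h2 => (dvd_normalize_iff).2 (EuclideanDomain.dvd_gcd h1 h2)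

/-- Existence of the gcd in the monoid of monic polynomials. -/
theorem MonicPoly.exists_gcd (A B : MonicPoly F) :
    ∃ D : MonicPoly F, D ∣ A ∧ D ∣ B ∧ ∀ C : F[X], C ∣ A.1 → C ∣ B.1 → C ∣ D.1 := by
  simpa only [MonicPoly.dvd_iff (B := A)] using MonicPoly.exists_gcd_of_polynomial A.1 B

/-- The family must be nonempty: the empty gcd is `0`, whereas the empty lcm is `1`. -/
theorem gcdFam_monic {k : ℕ} (hk : 1 ≤ k) (G : Fin k → MonicPoly F) : (gcdFam G).Monic := by
  let : DecidableEq F := Classical.decEq F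
  let := polyNormalizedGCDMonoid F
  have h0 : gcdFam G ≠ 0 := by
    intro h
    exact (G ⟨0, hk⟩).ne_zero (Finset.gcd_eq_zero_iff.1 h _ (Finset.mem_univ _))
  refine (normalize_eq_self_iff_monic h0).1 ?_
  exact Finset.normalize_gcd

theorem dvd_gcdFam_iff {k : ℕ} (G : Fin k → MonicPoly F) (A : F[X]) :
    A ∣ gcdFam G ↔ ∀ i, A ∣ (G i).1 := by
  let := polyNormalizedGCDMonoid F
  unfold gcdFam
  rw [Finset.dvd_gcd_iff]
  simp

theorem lcmFam_dvd_iff {k : ℕ} (H : Fin k → MonicPoly F) (A : F[X]) :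
    lcmFam H ∣ A ↔ ∀ i, (H i).1 ∣ A := by
  let := polyNormalizedGCDMonoid F
  unfold lcmFam
  rw [Finset.lcm_dvd_iff]
  simp

theorem lcmFam_monic {k : ℕ} (H : Fin k → MonicPoly F) : (lcmFam H).Monic := by
  let : DecidableEq F := Classical.decEq F
  let := polyNormalizedGCDMonoid F
  have h0 : lcmFam H ≠ 0 := by
    intro h
    have h1 : lcmFam H ∣ ∏ i, (H i).1 :=
      (lcmFam_dvd_iff H _).2 fun i => Finset.dvd_prod_of_mem _ (Finset.mem_univ i)
    rw [h, zero_dvd_iff, Finset.prod_eq_zero_iff] at h1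
    obtain ⟨i, -, hi⟩ := h1
    exact (H i).ne_zero hi
  refine (normalize_eq_self_iff_monic h0).1 ?_
  exact Finset.normalize_lcm

end MonicMonoid

/-! ### Finite sums over divisors and factorizations. -/

section Divisors

variable {F : Type*} [Field F] [Finite F]

theorem finite_setOf_dvd (E : MonicPoly F) : {D : MonicPoly F | D ∣ E}.Finite := by
  refine Set.Finite.of_finite_image (f := Subtype.val)
    ((finite_monicDivisors E.ne_zero).subset ?_) Subtype.val_injective.injOn
  rintro _ ⟨D, hD, rfl⟩
  exact ⟨D.2, MonicPoly.dvd_iff.1 hD⟩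

/-- The finite set of monic divisors. -/
noncomputable def divs (E : MonicPoly F) : Finset (MonicPoly F) := (finite_setOf_dvd E).toFinset

@[simp] theorem mem_divs {D E : MonicPoly F} : D ∈ divs E ↔ D ∣ E := by simp [divs]

theorem finite_setOf_mul_eq (E : MonicPoly F) :
    {x : MonicPoly F × MonicPoly F | x.1 * x.2 = E}.Finite := by
  refine ((divs E) ×ˢ (divs E)).finite_toSet.subset ?_
  rintro ⟨A, B⟩ rfl
  simp

/-- The finite set of factorizations `E = A * B` into monic polynomials. -/
noncomputable def factorPairs (E : MonicPoly F) : Finset (MonicPoly F × MonicPoly F) :=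
  (finite_setOf_mul_eq E).toFinset

@[simp] theorem mem_factorPairs {x : MonicPoly F × MonicPoly F} {E : MonicPoly F} :
    x ∈ factorPairs E ↔ x.1 * x.2 = E := by simp [factorPairs]

variable {α : Type*} [AddCommMonoid α]

theorem sum_factorPairs_fst (E : MonicPoly F) (f : MonicPoly F → α) :
    ∑ x ∈ factorPairs E, f x.1 = ∑ D ∈ divs E, f D := by
  refine Finset.sum_nbij Prod.fst ?_ ?_ ?_ fun _ _ => rfl
  · intro x hx
    rw [mem_factorPairs] at hx
    exact mem_divs.2 ⟨x.2, hx.symm⟩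
  · rintro ⟨A, B⟩ hx ⟨A', B'⟩ hy (rfl : A = A')
    simp only [Finset.mem_coe, mem_factorPairs] at hx hy
    rw [MonicPoly.mul_left_cancel' (hx.trans hy.symm)]
  · intro D hD
    obtain ⟨C, rfl⟩ := mem_divs.1 hD
    exact ⟨(D, C), by simp, rfl⟩

theorem sum_factorPairs_swap (E : MonicPoly F) (f : MonicPoly F → MonicPoly F → α) :
    ∑ x ∈ factorPairs E, f x.1 x.2 = ∑ x ∈ factorPairs E, f x.2 x.1 := by
  refine Finset.sum_nbij' Prod.swap Prod.swap ?_ ?_ ?_ ?_ ?_ <;> simp [mul_comm]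

theorem sum_factorPairs_snd (E : MonicPoly F) (f : MonicPoly F → α) :
    ∑ x ∈ factorPairs E, f x.2 = ∑ D ∈ divs E, f D := by
  rw [← sum_factorPairs_fst, sum_factorPairs_swap E fun a _ => f a]

/-- Associativity of Dirichlet convolution: both sides run over triples with product `E`. -/
theorem sum_factorPairs_assoc (E : MonicPoly F)
    (f : MonicPoly F → MonicPoly F → MonicPoly F → α) :
    ∑ x ∈ factorPairs E, ∑ y ∈ factorPairs x.2, f x.1 y.1 y.2 =
      ∑ x ∈ factorPairs E, ∑ y ∈ factorPairs x.1, f y.1 y.2 x.2 := by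
  rw [Finset.sum_sigma', Finset.sum_sigma']
  refine Finset.sum_nbij' (fun z => ⟨(z.1.1 * z.2.1, z.2.2), (z.1.1, z.2.1)⟩)
    (fun z => ⟨(z.2.1, z.2.2 * z.1.2), (z.2.2, z.1.2)⟩) ?_ ?_ ?_ ?_ ?_
  · rintro ⟨⟨a, b⟩, c, d⟩ h
    simp only [Finset.mem_sigma, mem_factorPairs] at h ⊢
    rw [mul_assoc, h.2, h.1]
    simp
  · rintro ⟨⟨a, b⟩, c, d⟩ h
    simp only [Finset.mem_sigma, mem_factorPairs] at h ⊢
    rw [← mul_assoc, h.2, h.1]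
    simp
  · rintro ⟨⟨a, b⟩, c, d⟩ h
    simp only [Finset.mem_sigma, mem_factorPairs] at h ⊢
    simp [h.2]
  · rintro ⟨⟨a, b⟩, c, d⟩ h
    simp only [Finset.mem_sigma, mem_factorPairs] at h ⊢
    simp [h.2]
  · simp

end Divisors

/-! ### The Möbius function and Möbius inversion. -/

section Moebius

variable {F : Type*} [Field F]

theorem moebius_of_not_squarefree {G : F[X]} (h : ¬ Squarefree G) : moebius G = 0 := if_neg h

theorem moebius_one : moebius (1 : F[X]) = 1 := by
  simp [moebius]

theorem abs_moebius_le_one (G : F[X]) : |(moebius G : ℝ)| ≤ 1 := by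
  unfold moebius
  split_ifs <;> simp

theorem moebius_mul {A B : F[X]} (hA : A ≠ 0) (hB : B ≠ 0) (h : IsCoprime A B) :
    moebius (A * B) = moebius A * moebius B := by
  unfold moebius
  rw [squarefree_mul_iff]
  have h1 := Multiset.card_eq_card_of_rel (UniqueFactorizationMonoid.factors_mul hA hB)
  have h2 := h.isRelPrime
  by_cases hsA : Squarefree A <;> by_cases hsB : Squarefree B <;>
    simp [h2, hsA, hsB, h1, pow_add]

theorem moebius_mul_eq_zero {A B : F[X]} (h : ¬ IsCoprime A B) : moebius (A * B) = 0 := by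
  refine moebius_of_not_squarefree fun hs => h ?_
  exact (squarefree_mul_iff.1 hs).1.isCoprime

theorem moebius_irreducible {P : F[X]} (hP : Irreducible P) : moebius P = -1 := by
  have h := UniqueFactorizationMonoid.factors_prod hP.ne_zero
  have hc : (UniqueFactorizationMonoid.factors P).card = 1 := by
    have := Multiset.card_eq_card_of_rel (UniqueFactorizationMonoid.factors_unique
      (fun x hx => UniqueFactorizationMonoid.irreducible_of_factor x hx)
      (g := {P}) (by simpa using hP) (by simpa using h))
    simpa using this
  rw [moebius, if_pos hP.squarefree, hc, pow_one]

/-- For `E ≠ 1` fix a monic irreducible `P ∣ E`. The divisors `D` prime to `P` cancel against `P *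
D`; every other divisor is divisible by `P ^ 2` and has `μ = 0`. -/
theorem sum_moebius_divs [Finite F] (E : MonicPoly F) [Decidable (E = 1)] :
    ∑ D ∈ divs E, (moebius D.1 : ℝ) = if E = 1 then 1 else 0 := by
  classical
  split_ifs with hE
  · subst hE
    have : divs (1 : MonicPoly F) = {1} := by
      ext D
      rw [mem_divs, Finset.mem_singleton, MonicPoly.dvd_iff, MonicPoly.eq_one_iff_isUnit,
        MonicPoly.coe_one, isUnit_iff_dvd_one]
    simp [this, moebius_one]
  · obtain ⟨P, hPm, hPi, hPE⟩ := exists_monic_irreducible_factor E.1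
      (mt MonicPoly.eq_one_iff_isUnit.2 hE)
    lift P to MonicPoly F using hPm
    have hcop : ∀ D : F[X], ¬ P.1 ∣ D → IsCoprime P.1 D := fun D h =>
      (hPi.coprime_iff_not_dvd).2 h
    have hmul : ∀ D : MonicPoly F, ¬ P ∣ D → (moebius (P * D).1 : ℝ) = - moebius D.1 := by
      intro D h
      rw [MonicPoly.coe_mul, moebius_mul (MonicPoly.ne_zero P) D.ne_zero
        (hcop _ (mt MonicPoly.dvd_iff.2 h)), moebius_irreducible hPi]
      simp
    rw [← Finset.sum_filter_add_sum_filter_not _ (fun D : MonicPoly F => P ∣ D)]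
    have key : ∑ D ∈ divs E with P ∣ D, (moebius D.1 : ℝ) =
        ∑ D ∈ divs E with ¬ P ∣ D, (moebius (P * D).1 : ℝ) := by
      symm
      refine Finset.sum_of_injOn (fun D => P * D) ?_ ?_ ?_ fun _ _ => rfl
      · intro A _ B _ h
        exact MonicPoly.mul_left_cancel' h
      · intro D hD
        simp only [Finset.coe_filter, mem_divs, Set.mem_ofPred_eq] at hD ⊢
        refine ⟨MonicPoly.dvd_iff.2 ?_, dvd_mul_right _ _⟩
        exact (hcop D.1 (mt MonicPoly.dvd_iff.2 hD.2)).mul_dvd hPE (MonicPoly.dvd_iff.1 hD.1)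
      · intro D hD hD'
        simp only [Finset.mem_filter, mem_divs] at hD
        obtain ⟨hDE, C, rfl⟩ := hD
        rw [MonicPoly.coe_mul, moebius_mul_eq_zero, Int.cast_zero]
        intro hc
        refine hD' ⟨C, ?_, rfl⟩
        simp only [Finset.coe_filter, mem_divs, Set.mem_ofPred_eq]
        refine ⟨(dvd_mul_left _ _).trans hDE, fun h => ?_⟩
        exact (hPi.coprime_iff_not_dvd).1 hc (MonicPoly.dvd_iff.1 h)
    rw [key, ← Finset.sum_add_distrib]
    refine Finset.sum_eq_zero fun D hD => ?_
    rw [hmul D (Finset.mem_filter.1 hD).2, neg_add_cancel]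

/-- Möbius inversion. -/
theorem moebius_inversion [Finite F] (f : MonicPoly F → ℂ) (E : MonicPoly F) :
    ∑ x ∈ factorPairs E, (moebius x.1.1 : ℂ) * ∑ D ∈ divs x.2, f D = f E := by
  classical
  have h1 : ∀ x ∈ factorPairs E, (moebius x.1.1 : ℂ) * ∑ D ∈ divs x.2, f D =
      ∑ y ∈ factorPairs x.2, (moebius x.1.1 : ℂ) * f y.2 := by
    intro x _
    rw [← Finset.mul_sum, sum_factorPairs_snd]
  rw [Finset.sum_congr rfl h1,
    sum_factorPairs_assoc E fun a _ c => (moebius a.1 : ℂ) * f c]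
  have h2 : ∀ x ∈ factorPairs E, ∑ y ∈ factorPairs x.1, (moebius y.1.1 : ℂ) * f x.2 =
      if x = (1, E) then f E else 0 := by
    intro x hx
    rw [← Finset.sum_mul, sum_factorPairs_fst x.1 fun D => (moebius D.1 : ℂ)]
    have h3 := congrArg (fun t : ℝ => (t : ℂ)) (sum_moebius_divs x.1)
    simp only [Complex.ofReal_sum, Complex.ofReal_intCast] at h3
    rw [h3]
    rw [mem_factorPairs] at hx
    by_cases h : x.1 = 1
    · have : x = (1, E) := Prod.ext h (by rw [← hx, h, one_mul])
      subst this
      simp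
    · have : x ≠ (1, E) := fun h' => h (by rw [h'])
      simp [h, this]
  rw [Finset.sum_congr rfl h2, Finset.sum_ite_eq' (factorPairs E) (1, E)]
  simp

end Moebius

/-! ### The weight `|E| ^ (-r)` and convergence of the zeta function. -/

section Weight

variable {F : Type*} [Field F]

theorem absv_pos [Finite F] (G : F[X]) : 0 < absv G := by
  unfold absv
  have : 0 < Nat.card F := Nat.card_pos
  positivity

theorem absv_mul (A B : MonicPoly F) : absv (A * B).1 = absv A.1 * absv B.1 := by
  rw [MonicPoly.coe_mul, absv, absv, absv, A.2.natDegree_mul B.2, pow_add]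

/-- The completely multiplicative weight `|E| ^ (-r)`. -/
noncomputable def weight (r : ℝ) (E : MonicPoly F) : ℝ := absv E.1 ^ (-r)

theorem weight_pos [Finite F] (r : ℝ) (E : MonicPoly F) : 0 < weight r E := Real.rpow_pos_of_pos (absv_pos _) _

theorem weight_mul [Finite F] (r : ℝ) (A B : MonicPoly F) : weight r (A * B) = weight r A * weight r B := by
  rw [weight, absv_mul, Real.mul_rpow (absv_pos _).le (absv_pos _).le]
  rfl

@[simp] theorem weight_one (r : ℝ) : weight r (1 : MonicPoly F) = 1 := by
  simp [weight, absv]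

theorem card_degreeLT (n : ℕ) : Nat.card (degreeLT F n) = Nat.card F ^ n := by
  rw [Nat.card_congr (degreeLTEquiv F n).toEquiv, Nat.card_fun, Nat.card_fin]

/-- There are `q ^ n` monic polynomials of degree `n`, so grouping by degree gives a geometric
series of ratio `q ^ (1 - r) < 1`. -/
theorem summable_weight [Finite F] {r : ℝ} (hr : 1 < r) : Summable fun E : MonicPoly F => weight r E := by
  set q : ℝ := (Nat.card F : ℝ) with hq
  have hq1 : 1 < q := by
    rw [hq]
    exact_mod_cast Finite.one_lt_card
  have hq0 : 0 < q := one_pos.trans hq1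
  have e : ∀ n, {E : MonicPoly F // E.1.natDegree = n} ≃ degreeLT F n := fun n =>
    (Equiv.subtypeSubtypeEquivSubtypeInter (fun f : F[X] => f.Monic)
      (fun f => f.natDegree = n)).trans (monicEquivDegreeLT n)
  have hfin : ∀ n, Finite (degreeLT F n) := fun n =>
    Finite.of_equiv _ (degreeLTEquiv F n).symm.toEquiv
  have hfin' : ∀ n, Finite {E : MonicPoly F // E.1.natDegree = n} := fun n =>
    Finite.of_equiv _ (e n).symm
  rw [← (Equiv.sigmaFiberEquiv fun E : MonicPoly F => E.1.natDegree).summable_iff,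
    summable_sigma_of_nonneg (by intro; exact (weight_pos _ _).le)]
  refine ⟨fun n => Summable.of_finite, ?_⟩
  have hval : ∀ n, (∑' y : {E : MonicPoly F // E.1.natDegree = n},
      ((fun E => weight r E) ∘ (Equiv.sigmaFiberEquiv fun E : MonicPoly F => E.1.natDegree))
        ⟨n, y⟩) = (q ^ (1 - r)) ^ n := by
    intro n
    have h1 : ∀ y : {E : MonicPoly F // E.1.natDegree = n},
      ((fun E => weight r E) ∘ (Equiv.sigmaFiberEquiv fun E : MonicPoly F => E.1.natDegree))
        ⟨n, y⟩ = (q ^ n) ^ (-r) := by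
      rintro ⟨E, rfl⟩
      rfl
    rw [tsum_congr h1, tsum_const, Nat.card_congr (e n), card_degreeLT, nsmul_eq_mul,
      Nat.cast_pow, ← hq, ← Real.rpow_natCast, ← Real.rpow_natCast, ← Real.rpow_mul hq0.le,
      ← Real.rpow_mul hq0.le, ← Real.rpow_add hq0]
    congr 1
    ring
  simp_rw [hval]
  refine summable_geometric_of_lt_one (by positivity) ?_
  exact Real.rpow_lt_one_of_one_lt_of_neg hq1 (by linarith)

theorem zetaA_eq_tsum_weight [Finite F] (r : ℝ) : zetaA F r = ∑' E : MonicPoly F, weight r E := by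
  refine tsum_congr fun E => ?_
  rw [weight, Real.rpow_neg (absv_pos _).le, one_div]

end Weight

/-! ### Dirichlet series with Möbius coefficients. -/

section Convolution

variable {F : Type*} [Field F] [Finite F]

/-- Dirichlet convolution of absolutely convergent series over monic polynomials. -/
theorem hasSum_convolution {a b : MonicPoly F → ℝ} (ha : Summable a) (hb : Summable b) :
    HasSum (fun E => ∑ x ∈ factorPairs E, a x.1 * b x.2) ((∑' E, a E) * ∑' E, b E) := by
  have hp : Summable fun z : MonicPoly F × MonicPoly F => a z.1 * b z.2 :=
    summable_mul_of_summable_norm ha.norm hb.norm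
  rw [tsum_mul_tsum_of_summable_norm ha.norm hb.norm]
  let e := Equiv.sigmaFiberEquiv fun z : MonicPoly F × MonicPoly F => z.1 * z.2
  have h1 : HasSum ((fun z : MonicPoly F × MonicPoly F => a z.1 * b z.2) ∘ e)
      (∑' z : MonicPoly F × MonicPoly F, a z.1 * b z.2) := (e.hasSum_iff).2 hp.hasSum
  refine h1.sigma fun E => ?_
  have h2 := (factorPairs E).hasSum fun z => a z.1 * b z.2
  let e' : {z : MonicPoly F × MonicPoly F // z.1 * z.2 = E} ≃ {z // z ∈ factorPairs E} :=
    Equiv.subtypeEquivRight fun z => mem_factorPairs.symm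
  exact (e'.hasSum_iff).2 h2

/-- Each divisor `D` of `A * B` is `C * D'` with `C = gcd(A, D)`; then `D'` is coprime to `A / C`,
hence divides `B`. -/
theorem card_divs_mul_le (A B : MonicPoly F) :
    (divs (A * B)).card ≤ (divs A).card * (divs B).card := by
  classical
  rw [← Finset.card_product]
  refine (Finset.card_le_card ?_).trans (Finset.card_image_le (f := fun z => z.1 * z.2))
  intro D hD
  rw [mem_divs] at hD
  obtain ⟨C, ⟨A', rfl⟩, hCD, hg⟩ := MonicPoly.exists_gcd A D
  obtain ⟨D', rfl⟩ := hCD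
  have hcop : IsCoprime D'.1 A'.1 := by
    refine IsRelPrime.isCoprime fun u hu1 hu2 => ?_
    have h := hg (C.1 * u) (mul_dvd_mul_left _ hu2) (mul_dvd_mul_left _ hu1)
    rw [← mul_one C.1, mul_assoc, one_mul] at h
    exact isUnit_of_dvd_one ((mul_dvd_mul_iff_left C.ne_zero).1 h)
  rw [Finset.mem_image]
  refine ⟨(C, D'), ?_, rfl⟩
  rw [Finset.mem_product, mem_divs, mem_divs]
  refine ⟨dvd_mul_right _ _, MonicPoly.dvd_iff.2 ?_⟩
  rw [MonicPoly.dvd_iff] at hD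
  simp only [MonicPoly.coe_mul, mul_assoc] at hD
  exact hcop.dvd_of_dvd_mul_left ((mul_dvd_mul_iff_left C.ne_zero).1 hD)

/-- One factor `d(E)` is spent as the number of factorizations `E = A * B`; submultiplicativity of
`d` then bounds the exponent `k + 1` series by the convolution of the exponent `k` series with
itself. -/
theorem summable_card_divs_pow_mul_weight {r : ℝ} (hr : 1 < r) (k : ℕ) :
    Summable fun E : MonicPoly F => ((divs E).card : ℝ) ^ k * weight r E := by
  induction k with
  | zero => simpa using summable_weight hr
  | succ k ih =>
    refine Summable.of_nonneg_of_le (fun E => ?_) (fun E => ?_) (hasSum_convolution ih ih).summable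
    · have := weight_pos r E
      positivity
    · have h1 : ((divs E).card : ℝ) ^ (k + 1) * weight r E =
          ∑ x ∈ factorPairs E, ((divs E).card : ℝ) ^ k * weight r E := by
        rw [sum_factorPairs_fst E fun _ => ((divs E).card : ℝ) ^ k * weight r E,
          Finset.sum_const, nsmul_eq_mul]
        ring
      rw [h1]
      refine Finset.sum_le_sum fun x hx => ?_
      rw [← mem_factorPairs.1 hx, weight_mul]
      have h2 : ((divs (x.1 * x.2)).card : ℝ) ≤ (divs x.1).card * (divs x.2).card := by
        exact_mod_cast card_divs_mul_le x.1 x.2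
      have h3 := weight_pos r x.1
      have h4 := weight_pos r x.2
      calc ((divs (x.1 * x.2)).card : ℝ) ^ k * (weight r x.1 * weight r x.2)
          ≤ ((divs x.1).card * (divs x.2).card : ℝ) ^ k * (weight r x.1 * weight r x.2) := by
            gcongr
        _ = _ := by ring

theorem summable_of_abs_le_weight {r : ℝ} (hr : 1 < r) {a : MonicPoly F → ℝ}
    (h : ∀ E, |a E| ≤ weight r E) : Summable a :=
  Summable.of_norm_bounded (summable_weight hr) h

theorem abs_moebius_mul_weight_le (r : ℝ) (E D : MonicPoly F) :
    |(moebius D.1 : ℝ) * weight r E| ≤ weight r E := by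
  rw [abs_mul, abs_of_pos (weight_pos r E)]
  exact mul_le_of_le_one_left (weight_pos r E).le (abs_moebius_le_one _)

theorem summable_moebius_mul_weight {r : ℝ} (hr : 1 < r) :
    Summable fun E : MonicPoly F => (moebius E.1 : ℝ) * weight r E :=
  summable_of_abs_le_weight hr fun E => abs_moebius_mul_weight_le r E E

theorem tsum_moebius_mul_zetaA {r : ℝ} (hr : 1 < r) :
    (∑' E : MonicPoly F, (moebius E.1 : ℝ) * weight r E) * zetaA F r = 1 := by
  classical
  rw [zetaA_eq_tsum_weight]
  refine (hasSum_convolution (summable_moebius_mul_weight hr) (summable_weight hr)).unique ?_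
  have h : ∀ E : MonicPoly F, ∑ x ∈ factorPairs E,
      (moebius x.1.1 : ℝ) * weight r x.1 * weight r x.2 = if E = 1 then 1 else 0 := by
    intro E
    have h1 : ∀ x ∈ factorPairs E, (moebius x.1.1 : ℝ) * weight r x.1 * weight r x.2 =
        (moebius x.1.1 : ℝ) * weight r E := by
      intro x hx
      rw [mul_assoc, ← weight_mul, mem_factorPairs.1 hx]
    rw [Finset.sum_congr rfl h1, ← Finset.sum_mul,
      sum_factorPairs_fst E fun D => (moebius D.1 : ℝ), sum_moebius_divs]
    split_ifs with hE
    · simp [hE]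
    · simp
  simp_rw [h]
  exact hasSum_ite_eq 1 1

open Classical in
-- A squarefree `E` has exactly one factorization `A * B` with `A ∣ Q` and `B` coprime to `Q`,
-- namely with `A = gcd(E, Q)`. For other `E` each admissible term is `μ(A * B) = 0`.
theorem sum_factorPairs_moebius_coprime (Q E : MonicPoly F) :
    ∑ x ∈ factorPairs E, (if x.1 ∣ Q then (moebius x.1.1 : ℝ) else 0) *
      (if IsCoprime Q.1 x.2.1 then (moebius x.2.1 : ℝ) else 0) =
    moebius E.1 := by
  have hterm : ∀ A B : MonicPoly F, A ∣ Q → IsCoprime Q.1 B.1 →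
      (moebius A.1 : ℝ) * moebius B.1 = moebius (A * B).1 := by
    intro A B hA hB
    rw [MonicPoly.coe_mul, moebius_mul A.ne_zero B.ne_zero
      (hB.of_isCoprime_of_dvd_left (MonicPoly.dvd_iff.1 hA)), Int.cast_mul]
  by_cases hE : Squarefree E.1
  · obtain ⟨D, ⟨M, rfl⟩, hDQ, hg⟩ := MonicPoly.exists_gcd E Q
    have hDM : IsCoprime D.1 M.1 := (squarefree_mul_iff.1 hE).1.isCoprime
    have hQM : IsCoprime Q.1 M.1 := by
      refine IsRelPrime.isCoprime fun u hu1 hu2 => ?_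
      exact hDM.isRelPrime (hg u (hu2.mul_left _) hu1) hu2
    rw [Finset.sum_eq_single (D, M)]
    · rw [if_pos hDQ, if_pos hQM, hterm D M hDQ hQM]
    · rintro ⟨A, B⟩ hx hne
      rw [mem_factorPairs] at hx
      by_cases hA : A ∣ Q
      · by_cases hB : IsCoprime Q.1 B.1
        · exfalso
          apply hne
          have hAD : A ∣ D := MonicPoly.dvd_iff.2
            (hg _ (MonicPoly.dvd_iff.1 ⟨B, hx.symm⟩) (MonicPoly.dvd_iff.1 hA))
          have hDA : D ∣ A := by
            rw [MonicPoly.dvd_iff]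
            refine (hB.of_isCoprime_of_dvd_left (MonicPoly.dvd_iff.1 hDQ)).dvd_of_dvd_mul_right ?_
            exact MonicPoly.dvd_iff.1 ⟨M, hx⟩
          have hAD' : A = D := Subtype.ext (eq_of_monic_of_associated A.2 D.2
            (associated_of_dvd_dvd (MonicPoly.dvd_iff.1 hAD) (MonicPoly.dvd_iff.1 hDA)))
          subst hAD'
          rw [MonicPoly.mul_left_cancel' (B := B) (C := M) hx]
        · rw [if_neg hB, mul_zero]
      · rw [if_neg hA, zero_mul]
    · intro h
      simp at h
  · rw [moebius_of_not_squarefree hE, Int.cast_zero]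
    refine Finset.sum_eq_zero fun x hx => ?_
    split_ifs with hA hB
    · rw [hterm _ _ hA hB, mem_factorPairs.1 hx, moebius_of_not_squarefree hE, Int.cast_zero]
    all_goals simp

/-- The totient `φ_s(G)` as a sum over factorizations of `G`. -/
theorem jordan_eq_sum (s : ℝ) (G : MonicPoly F) :
    jordan s G.1 = ∑ x ∈ factorPairs G, (moebius x.1.1 : ℝ) * absv x.2.1 ^ s := by
  have h1 : monicDivisors G.1 = Subtype.val '' (divs G : Set (MonicPoly F)) := by
    ext D
    simp only [monicDivisors, Set.mem_image, Finset.mem_coe, mem_divs, MonicPoly.dvd_iff,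
      Set.mem_ofPred_eq]
    exact ⟨fun h => ⟨⟨D, h.1⟩, h.2, rfl⟩, fun ⟨E, hE, h⟩ => h ▸ ⟨E.2, hE⟩⟩
  rw [jordan, h1, finsum_mem_image Subtype.val_injective.injOn, finsum_mem_coe_finset,
    ← sum_factorPairs_snd G fun D => (moebius (G.1 / D.1) : ℝ) * absv D.1 ^ s]
  refine Finset.sum_congr rfl fun x hx => ?_
  rw [← mem_factorPairs.1 hx, MonicPoly.coe_mul, mul_div_cancel_right₀ _ x.2.ne_zero]

/-- `φ_s(G) / |G| ^ s` as a sum over divisors of `G`. -/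
theorem jordan_mul_weight (s : ℝ) (G : MonicPoly F) :
    jordan s G.1 * weight s G = ∑ D ∈ divs G, (moebius D.1 : ℝ) * weight s D := by
  rw [jordan_eq_sum, Finset.sum_mul, ← sum_factorPairs_fst]
  refine Finset.sum_congr rfl fun x hx => ?_
  rw [← mem_factorPairs.1 hx, weight_mul]
  have h : absv x.2.1 ^ s * weight s x.2 = 1 := by
    rw [weight, ← Real.rpow_add (absv_pos _), add_neg_cancel, Real.rpow_zero]
  linear_combination (moebius x.1.1 : ℝ) * weight s x.1 * h

open Classical in
-- Splits `∑ μ(E) |E|^(-r)` into the part supported on divisors of `Q`, a finite sum equal to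
-- `φ_r(Q) / |Q|^r`, and the part coprime to `Q`. This replaces an Euler product.
theorem tsum_coprime_moebius {r : ℝ} (hr : 1 < r) (Q : MonicPoly F) :
    jordan r Q.1 * weight r Q *
      (∑' E : MonicPoly F, if IsCoprime Q.1 E.1 then (moebius E.1 : ℝ) * weight r E else 0) =
    ∑' E : MonicPoly F, (moebius E.1 : ℝ) * weight r E := by
  have hle : ∀ (P : MonicPoly F → Prop) (E : MonicPoly F),
      |if P E then (moebius E.1 : ℝ) * weight r E else 0| ≤ weight r E := by
    intro P E
    split_ifs
    · exact abs_moebius_mul_weight_le r E E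
    · simpa using (weight_pos r E).le
  have ha := summable_of_abs_le_weight hr (hle fun E => E ∣ Q)
  have hb := summable_of_abs_le_weight hr (hle fun E => IsCoprime Q.1 E.1)
  have hconv := hasSum_convolution ha hb
  have hfin : ∑' E : MonicPoly F, (if E ∣ Q then (moebius E.1 : ℝ) * weight r E else 0) =
      jordan r Q.1 * weight r Q := by
    rw [jordan_mul_weight, tsum_eq_sum (s := divs Q)]
    · refine Finset.sum_congr rfl fun D hD => if_pos (mem_divs.1 hD)
    · intro D hD
      exact if_neg (mt mem_divs.2 hD)
  rw [hfin] at hconv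
  rw [← hconv.tsum_eq]
  refine tsum_congr fun E => ?_
  have h := sum_factorPairs_moebius_coprime Q E
  rw [← h, Finset.sum_mul]
  refine Finset.sum_congr rfl fun x hx => ?_
  rw [← mem_factorPairs.1 hx, weight_mul]
  split_ifs <;> ring

theorem zetaA_ne_zero {r : ℝ} (hr : 1 < r) : zetaA F r ≠ 0 :=
  right_ne_zero_of_mul_eq_one (tsum_moebius_mul_zetaA hr)

/-- `φ_r(Q)` is a factor of `1 / ζ(r)`, which is nonzero. -/
theorem jordan_ne_zero {r : ℝ} (hr : 1 < r) (Q : MonicPoly F) : jordan r Q.1 ≠ 0 := by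
  intro h
  have h1 := tsum_coprime_moebius hr Q
  rw [h, zero_mul, zero_mul] at h1
  exact left_ne_zero_of_mul_eq_one (tsum_moebius_mul_zetaA (F := F) hr) h1.symm

open Classical in
/-- The sum of `μ(E) |E| ^ (-r)` over the multiples `E` of `Q`. -/
theorem tsum_multiples_moebius {r : ℝ} (hr : 1 < r) (Q : MonicPoly F) :
    ∑' E : MonicPoly F, (if Q ∣ E then (moebius E.1 : ℝ) * weight r E else 0) =
      moebius Q.1 / (zetaA F r * jordan r Q.1) := by
  have h1 : ∑' E : MonicPoly F, (if Q ∣ E then (moebius E.1 : ℝ) * weight r E else 0) =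
      ∑' M : MonicPoly F, (moebius Q.1 * weight r Q) *
        if IsCoprime Q.1 M.1 then (moebius M.1 : ℝ) * weight r M else 0 := by
    -- Substitute `E = Q * M`; `μ(Q * M)` vanishes unless `M` is coprime to `Q`.
    rw [← Function.Injective.tsum_eq (g := fun M => Q * M)
      fun _ _ h => MonicPoly.mul_left_cancel' h]
    · refine tsum_congr fun M => ?_
      rw [if_pos (dvd_mul_right _ _), weight_mul, MonicPoly.coe_mul]
      split_ifs with h
      · rw [moebius_mul Q.ne_zero M.ne_zero h, Int.cast_mul]
        ring
      · rw [moebius_mul_eq_zero h, Int.cast_zero, zero_mul, mul_zero]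
    · intro E hE
      by_contra hn
      refine hE (if_neg ?_)
      rintro ⟨M, rfl⟩
      exact hn ⟨M, rfl⟩
  have h2 := tsum_coprime_moebius hr Q
  have h3 := tsum_moebius_mul_zetaA (F := F) hr
  have h4 := zetaA_ne_zero (F := F) hr
  have h5 := jordan_ne_zero hr Q
  rw [h1, tsum_mul_left, eq_div_iff (mul_ne_zero h4 h5)]
  rw [← h2] at h3
  linear_combination (moebius Q.1 : ℝ) * h3

end Convolution

/-! ### Additive characters and Ramanujan sums. -/

section Character

variable {F : Type*} [Field F] (p : ℕ) [Fact p.Prime] [Algebra (ZMod p) F]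

theorem baseChar_eq (a : F) : baseChar p a = ZMod.stdAddChar (Algebra.trace (ZMod p) F a) := by
  rw [ZMod.stdAddChar_apply, ZMod.toCircle_apply, baseChar, mul_div_assoc]

@[simp] theorem baseChar_zero : baseChar p (0 : F) = 1 := by
  rw [baseChar_eq, map_zero, AddChar.map_zero_eq_one]

theorem baseChar_add (a b : F) : baseChar p (a + b) = baseChar p a * baseChar p b := by
  simp only [baseChar_eq, map_add, AddChar.map_add_eq_mul]

theorem exists_baseChar_ne_one [Finite F] : ∃ a : F, baseChar p a ≠ 1 := by
  have := Module.Finite.of_finite (R := ZMod p) (M := F)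
  obtain ⟨a, ha⟩ := Algebra.trace_surjective (ZMod p) F 1
  refine ⟨a, fun h => ?_⟩
  rw [baseChar_eq, ha, ← AddChar.map_zero_eq_one (ZMod.stdAddChar (N := p))] at h
  exact one_ne_zero (ZMod.injective_stdAddChar h)

theorem charE_add (G H A B : F[X]) :
    charE p G H (A + B) = charE p G H A * charE p G H B := by
  rw [charE, mul_add, tCoeff, add_mod, coeff_add, baseChar_add]
  rfl

/-- The remainder of `K * A` modulo `K * H` is `K * (A % H)`, and `K` is monic, so the coefficient
just below the degree of the modulus is unchanged. -/
theorem tCoeff_mul_left (K H : MonicPoly F) (A : F[X]) :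
    tCoeff (K * H).1 (K.1 * A) = tCoeff H.1 A := by
  have h1 : (K.1 * A) % (K * H).1 = K.1 * (A % H.1) := by
    rw [MonicPoly.coe_mul]
    have h2 : K.1 * A = (K.1 * H.1) * (A / H.1) + K.1 * (A % H.1) := by
      rw [mul_assoc, ← mul_add, EuclideanDomain.div_add_mod]
    rw [h2, add_mod, (EuclideanDomain.mod_eq_zero).2 (dvd_mul_right _ _), zero_add]
    refine (mod_eq_self_iff (mul_ne_zero K.ne_zero H.ne_zero)).2 ?_
    rw [degree_mul, degree_mul]
    refine WithBot.add_lt_add_left ?_ (degree_mod_lt _ H.ne_zero)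
    rw [Ne, degree_eq_bot]
    exact K.ne_zero
  rw [tCoeff, tCoeff, h1, MonicPoly.coe_mul, K.2.natDegree_mul H.2]
  -- In degree `0` the index `natDegree - 1` truncates to `0`; there `H = 1` and all remainders
  -- vanish.
  rcases Nat.eq_zero_or_pos H.1.natDegree with h0 | h0
  · have hH : H.1 = 1 := H.2.natDegree_eq_zero.1 h0
    simp [hH]
  · have h3 : (A % H.1).natDegree ≤ H.1.natDegree - 1 := by
      have := natDegree_mod_lt A h0.ne'
      omega
    rw [Nat.add_sub_assoc h0, coeff_mul_add_eq_of_natDegree_le le_rfl h3, K.2.coeff_natDegree,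
      one_mul]

theorem charE_mul_left (K H : MonicPoly F) (G A : F[X]) :
    charE p G (K * H).1 (K.1 * A) = charE p G H.1 A := by
  rw [charE, charE, mul_left_comm, tCoeff_mul_left]

variable [Finite F]

open Classical in
/-- Orthogonality: the sum of `E(G, H)` over all residues modulo `H`. -/
theorem sum_charE (G : F[X]) (E : MonicPoly F) :
    ∑ D ∈ (finite_degree_lt F E.1).toFinset, charE p G E.1 D =
      if E.1 ∣ G then (absv E.1 : ℂ) else 0 := by
  set n := E.1.natDegree with hn
  have hdeg : ∀ D : F[X], D.degree < E.1.degree ↔ D ∈ degreeLT F n := fun D => by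
    rw [mem_degreeLT, hn, degree_eq_natDegree E.ne_zero]
  have hfin : Finite (degreeLT F n) := Finite.of_equiv _ (degreeLTEquiv F n).symm.toEquiv
  have := Fintype.ofFinite (degreeLT F n)
  let ψ : AddChar (degreeLT F n) ℂ :=
    { toFun := fun D => charE p G E.1 D.1
      map_zero_eq_one' := by simp [charE, tCoeff]
      map_add_eq_mul' := fun A B => charE_add p G E.1 A.1 B.1 }
  have hsum : ∑ D ∈ (finite_degree_lt F E.1).toFinset, charE p G E.1 D = ∑ D, ψ D := by
    symm
    refine Finset.sum_nbij Subtype.val ?_ Subtype.val_injective.injOn ?_ fun _ _ => rfl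
    · intro D _
      simp [hdeg]
    · intro D hD
      have hD' : D ∈ degreeLT F n := by simpa [hdeg] using hD
      exact ⟨⟨D, hD'⟩, by simp, rfl⟩
  rw [hsum]
  split_ifs with h
  · have h1 : ∀ D, ψ D = 1 := fun D => by
      change baseChar p (tCoeff E.1 (G * D.1)) = 1
      rw [tCoeff, (EuclideanDomain.mod_eq_zero).2 (h.mul_right _), coeff_zero, baseChar_zero]
    rw [Finset.sum_congr rfl fun D _ => h1 D, Finset.sum_const, Finset.card_univ,
      ← Nat.card_eq_fintype_card, card_degreeLT, nsmul_eq_mul, mul_one, absv]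
    push_cast
    rfl
  · rw [AddChar.sum_eq_zero_iff_ne_zero]
    intro h0
    obtain ⟨a, ha⟩ := exists_baseChar_ne_one (F := F) p
    set R := G % E.1 with hR
    have hR0 : R ≠ 0 := fun h' => h ((EuclideanDomain.mod_eq_zero).1 h')
    have hRlt : R.natDegree < n := by
      have hlt := degree_mod_lt G E.ne_zero
      exact natDegree_lt_natDegree hR0 hlt
    -- The residue `c T^m` is chosen so that `R * c T^m` needs no reduction: `m` moves the leading
    -- term of `R` to degree `n - 1`, and `c` turns its coefficient into `a`, where the base
    -- character is nontrivial.
    set m := n - 1 - R.natDegree with hm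
    set c := a / R.leadingCoeff with hc
    have hDlt : (C c * X ^ m : F[X]).degree < n := by
      refine (degree_C_mul_X_pow_le m c).trans_lt ?_
      exact_mod_cast (by omega : m < n)
    have h1 : ψ ⟨C c * X ^ m, mem_degreeLT.2 hDlt⟩ = baseChar p a := by
      change baseChar p (tCoeff E.1 (G * (C c * X ^ m))) = baseChar p a
      congr 1
      have h2 : (G * (C c * X ^ m)) % E.1 = R * (C c * X ^ m) := by
        have h3 : G * (C c * X ^ m) =
            E.1 * ((G / E.1) * (C c * X ^ m)) + R * (C c * X ^ m) := by
          rw [← mul_assoc E.1, ← add_mul, hR, EuclideanDomain.div_add_mod]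
        rw [h3, add_mod, (EuclideanDomain.mod_eq_zero).2 (dvd_mul_right _ _), zero_add]
        refine (mod_eq_self_iff E.ne_zero).2 ?_
        rw [degree_eq_natDegree E.ne_zero, ← hn, degree_mul, degree_eq_natDegree hR0]
        refine (add_le_add le_rfl (degree_C_mul_X_pow_le m c)).trans_lt ?_
        exact_mod_cast (by omega : R.natDegree + m < n)
      rw [tCoeff, h2, ← hn, show n - 1 = R.natDegree + m by omega, ← mul_assoc, coeff_mul_X_pow,
        coeff_mul_C, coeff_natDegree, hc, mul_div_cancel₀]
      exact leadingCoeff_ne_zero.2 hR0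
    rw [h0, AddChar.zero_apply] at h1
    exact ha h1.symm

theorem ramanujanSum_eq_sum (G : F[X]) (H : MonicPoly F) :
    ramanujanSum p G H.1 = ∑ D ∈ (finite_reducedResidues H.1).toFinset, charE p G H.1 D := by
  rw [ramanujanSum, finsum_mem_eq_finite_toFinset_sum _ (finite_reducedResidues H.1)]

open Classical in
-- Each residue `A` mod `E` is uniquely `K * D` with `K = gcd(A, E)`, `E = K * H` and `D` a reduced
-- residue mod `H`. By `charE_mul_left` the character values agree, so the full character sum splits
-- into Ramanujan sums.
theorem sum_divs_ramanujanSum (G : F[X]) (E : MonicPoly F) :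
    ∑ H ∈ divs E, ramanujanSum p G H.1 = if E.1 ∣ G then (absv E.1 : ℂ) else 0 := by
  rw [← sum_charE p, ← sum_factorPairs_snd]
  simp_rw [ramanujanSum_eq_sum]
  rw [Finset.sum_sigma']
  refine Finset.sum_nbij (fun z => z.1.1.1 * z.2) ?_ ?_ ?_ ?_
  · rintro ⟨⟨K, H⟩, D⟩ hz
    simp only [Finset.mem_sigma, mem_factorPairs, Set.Finite.mem_toFinset, reducedResidues,
      Set.mem_ofPred_eq] at hz ⊢
    rw [← hz.1, MonicPoly.coe_mul, degree_mul, degree_mul]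
    refine WithBot.add_lt_add_left ?_ hz.2.1
    rw [Ne, degree_eq_bot]
    exact K.ne_zero
  · rintro ⟨⟨K, H⟩, D⟩ hz ⟨⟨K', H'⟩, D'⟩ hz' heq
    simp only [Finset.mem_coe, Finset.mem_sigma, mem_factorPairs, Set.Finite.mem_toFinset,
      reducedResidues, Set.mem_ofPred_eq] at hz hz' heq
    -- Multiplying a Bézout relation for `D'` and `H'` by `K'` writes `K'` as a combination of `K *
    -- D` and `K * H`. By symmetry `K` and `K'` divide each other.
    have aux : ∀ (K H K' H' : MonicPoly F) (D D' : F[X]), K * H = K' * H' → K.1 * D = K'.1 * D' →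
        IsCoprime D' H'.1 → K.1 ∣ K'.1 := by
      rintro K H K' H' D D' h1 h2 ⟨u, v, huv⟩
      have h3 := congrArg Subtype.val h1
      simp only [MonicPoly.coe_mul] at h3
      refine ⟨u * D + v * H.1, ?_⟩
      linear_combination (-K'.1) * huv - u * h2 - v * h3
    have hK : K = K' := Subtype.ext (eq_of_monic_of_associated K.2 K'.2 (associated_of_dvd_dvd
      (aux K H K' H' D D' (hz.1.trans hz'.1.symm) heq hz'.2.2)
      (aux K' H' K H D' D (hz'.1.trans hz.1.symm) heq.symm hz.2.2)))
    subst hK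
    have hH : H = H' := MonicPoly.mul_left_cancel' (hz.1.trans hz'.1.symm)
    subst hH
    rw [mul_left_cancel₀ K.ne_zero heq]
  · intro A hA
    simp only [Set.Finite.coe_toFinset, Set.mem_ofPred_eq] at hA
    obtain ⟨K, ⟨D, rfl⟩, ⟨H, rfl⟩, hg⟩ := MonicPoly.exists_gcd_of_polynomial A E
    refine ⟨⟨(K, H), D⟩, ?_, rfl⟩
    simp only [Finset.mem_coe, Finset.mem_sigma, mem_factorPairs, Set.Finite.mem_toFinset,
      reducedResidues, Set.mem_ofPred_eq, true_and]
    constructor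
    · rw [MonicPoly.coe_mul, degree_mul, degree_mul] at hA
      exact lt_of_add_lt_add_left hA
    · refine IsRelPrime.isCoprime fun u hu1 hu2 => ?_
      have h := hg (K.1 * u) (mul_dvd_mul_left _ hu1) (mul_dvd_mul_left _ hu2)
      exact isUnit_of_dvd_one ((mul_dvd_mul_iff_left K.ne_zero).1 (by rwa [mul_one]))
  · rintro ⟨⟨K, H⟩, D⟩ hz
    simp only [Finset.mem_sigma, mem_factorPairs] at hz
    rw [← hz.1, charE_mul_left]

open Classical in
theorem ramanujanSum_eq_moebius (G : F[X]) (H : MonicPoly F) :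
    ramanujanSum p G H.1 = ∑ x ∈ factorPairs H,
      (moebius x.1.1 : ℂ) * if x.2.1 ∣ G then (absv x.2.1 : ℂ) else 0 := by
  rw [← moebius_inversion (fun H => ramanujanSum p G H.1) H]
  simp_rw [sum_divs_ramanujanSum]

/-- The point is uniformity in `H`: only common divisors of `G` and `H` contribute to the Möbius
formula for `η`. -/
theorem norm_ramanujanSum_le (G H : MonicPoly F) :
    ‖ramanujanSum p G.1 H.1‖ ≤ ∑ D ∈ divs G, absv D.1 := by
  classical
  rw [ramanujanSum_eq_moebius]
  refine (norm_sum_le _ _).trans ?_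
  calc ∑ x ∈ factorPairs H, ‖(moebius x.1.1 : ℂ) * if x.2.1 ∣ G.1 then (absv x.2.1 : ℂ) else 0‖
      ≤ ∑ x ∈ factorPairs H, if x.2 ∣ G then absv x.2.1 else 0 := by
        refine Finset.sum_le_sum fun x _ => ?_
        rw [norm_mul, Complex.norm_intCast, MonicPoly.dvd_iff]
        split_ifs
        · rw [Complex.norm_real, Real.norm_of_nonneg (absv_pos _).le]
          exact mul_le_of_le_one_left (absv_pos _).le (abs_moebius_le_one _)
        · simp
    _ = ∑ D ∈ divs H with D ∣ G, absv D.1 := by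
        rw [sum_factorPairs_snd H fun D => if D ∣ G then absv D.1 else 0, Finset.sum_filter]
    _ ≤ _ := by
        refine Finset.sum_le_sum_of_subset_of_nonneg (fun D hD => ?_) fun D _ _ => (absv_pos _).le
        exact mem_divs.2 (Finset.mem_filter.1 hD).2

end Character

/-- Euler's totient is `φ_1`. -/
theorem totient_eq_jordan {F : Type*} [Field F] [Finite F] (p : ℕ) [Fact p.Prime]
    [Algebra (ZMod p) F] (G : MonicPoly F) : (totient G.1 : ℝ) = jordan 1 G.1 := by
  classical
  -- `η(0, G)` counts reduced residues, since its character is trivial, and every divisor of `G`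
  -- divides `0`.
  have h := ramanujanSum_eq_moebius p 0 G
  have h1 : ∀ D : F[X], charE p 0 G.1 D = 1 := fun D => by simp [charE, tCoeff]
  rw [ramanujanSum_eq_sum, Finset.sum_congr rfl fun D _ => h1 D, Finset.sum_const, nsmul_eq_mul,
    mul_one, ← Set.ncard_eq_toFinset_card _ (finite_reducedResidues G.1)] at h
  rw [jordan_eq_sum, ← Complex.ofReal_inj, totient]
  simpa using h

/-! ### The double series and the exchange of summation. -/

section Expansion

variable {F : Type*} [Field F] [Finite F] (p : ℕ) [Fact p.Prime] [Algebra (ZMod p) F]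
  {k : ℕ} {r : ℝ} (G : Fin k → MonicPoly F)

open Classical in
/-- The terms of the double series over `E` and over `H_1, …, H_k ∣ E` from which the expansion
is obtained by exchanging the order of summation. -/
noncomputable def doubleTerm (r : ℝ) (G : Fin k → MonicPoly F) (E : MonicPoly F)
    (H : Fin k → MonicPoly F) : ℂ :=
  if ∀ i, H i ∣ E then
    ((moebius E.1 * weight r E : ℝ) : ℂ) * ∏ i, ramanujanSum p (G i).1 (H i).1
  else 0

theorem hasSum_doubleTerm (E : MonicPoly F) :
    HasSum (doubleTerm p r G E) (((moebius E.1 * weight r E : ℝ) : ℂ) *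
      ∏ i, ∑ H ∈ divs E, ramanujanSum p (G i).1 H.1) := by
  classical
  rw [Finset.prod_univ_sum, Finset.mul_sum]
  have h : ∀ H ∈ Fintype.piFinset fun _ : Fin k => divs E,
      ((moebius E.1 * weight r E : ℝ) : ℂ) * ∏ i, ramanujanSum p (G i).1 (H i).1 =
        doubleTerm p r G E H := by
    intro H hH
    rw [doubleTerm, if_pos]
    simpa [Fintype.mem_piFinset] using hH
  rw [Finset.sum_congr rfl h]
  refine hasSum_sum_of_ne_finset_zero fun H hH => if_neg ?_
  simpa [Fintype.mem_piFinset] using hH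

theorem hasSum_norm_doubleTerm (E : MonicPoly F) :
    HasSum (fun H => ‖doubleTerm p r G E H‖) (|(moebius E.1 * weight r E : ℝ)| *
      ∏ i, ∑ H ∈ divs E, ‖ramanujanSum p (G i).1 H.1‖) := by
  classical
  rw [Finset.prod_univ_sum, Finset.mul_sum]
  have h : ∀ H ∈ Fintype.piFinset fun _ : Fin k => divs E,
      |(moebius E.1 * weight r E : ℝ)| * ∏ i, ‖ramanujanSum p (G i).1 (H i).1‖ =
        ‖doubleTerm p r G E H‖ := by
    intro H hH
    rw [doubleTerm, if_pos, norm_mul, norm_prod, Complex.norm_real, Real.norm_eq_abs]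
    simpa [Fintype.mem_piFinset] using hH
  rw [Finset.sum_congr rfl h]
  refine hasSum_sum_of_ne_finset_zero fun H hH => ?_
  rw [doubleTerm, if_neg, norm_zero]
  simpa [Fintype.mem_piFinset] using hH

theorem summable_norm_doubleTerm (hr : 1 < r) :
    Summable fun z : MonicPoly F × (Fin k → MonicPoly F) => ‖doubleTerm p r G z.1 z.2‖ := by
  rw [summable_prod_of_nonneg fun _ => norm_nonneg _]
  refine ⟨fun E => (hasSum_norm_doubleTerm p G E).summable, ?_⟩
  simp_rw [(hasSum_norm_doubleTerm p G _).tsum_eq]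
  refine Summable.of_nonneg_of_le (fun E => by positivity) (fun E => ?_)
    ((summable_card_divs_pow_mul_weight (F := F) hr k).mul_left
      (∏ i, ∑ D ∈ divs (G i), absv D.1))
  have h1 : ∏ i, ∑ H ∈ divs E, ‖ramanujanSum p (G i).1 H.1‖ ≤
      ∏ i, (divs E).card * ∑ D ∈ divs (G i), absv D.1 := by
    refine Finset.prod_le_prod (fun i _ => by positivity) fun i _ => ?_
    rw [← nsmul_eq_mul]
    exact Finset.sum_le_card_nsmul _ _ _ fun H _ => norm_ramanujanSum_le p (G i) H
  rw [Finset.prod_mul_distrib, Finset.prod_const, Finset.card_univ, Fintype.card_fin] at h1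
  calc _ ≤ weight r E * ((divs E).card ^ k * ∏ i, ∑ D ∈ divs (G i), absv D.1) :=
        mul_le_mul (abs_moebius_mul_weight_le r E E) h1 (by positivity) (weight_pos r E).le
    _ = _ := by ring

/-- All `H_i` divide `E` exactly when their lcm `Q` does, so `tsum_multiples_moebius` applies. -/
theorem tsum_doubleTerm (hr : 1 < r) (H : Fin k → MonicPoly F) :
    ∑' E, doubleTerm p r G E H = expansionTerm p r G H / (zetaA F r : ℂ) := by
  classical
  set Q : MonicPoly F := ⟨lcmFam H, lcmFam_monic H⟩ with hQ
  have h1 : ∀ E, doubleTerm p r G E H =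
      ((if Q ∣ E then (moebius E.1 : ℝ) * weight r E else 0 : ℝ) : ℂ) *
        ∏ i, ramanujanSum p (G i).1 (H i).1 := by
    intro E
    have h2 : (∀ i, H i ∣ E) ↔ Q ∣ E := by
      simp only [MonicPoly.dvd_iff, hQ, lcmFam_dvd_iff]
    rw [doubleTerm, if_congr h2 rfl rfl]
    split_ifs <;> simp
  have h3 := zetaA_ne_zero (F := F) hr
  have h4 := jordan_ne_zero hr Q
  simp_rw [h1]
  rw [tsum_mul_right, ← Complex.ofReal_tsum, tsum_multiples_moebius hr, expansionTerm]
  have h5 : (zetaA F r : ℂ) ≠ 0 := by exact_mod_cast h3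
  have h6 : (jordan r Q.1 : ℂ) ≠ 0 := by exact_mod_cast h4
  change _ = (moebius Q.1 : ℂ) * _ / (jordan r Q.1 : ℂ) / _
  push_cast
  field_simp

/-- Each term is `ζ(r)` times a fibre sum of the absolutely summable double series. -/
theorem summable_norm_expansionTerm (hr : 1 < r) :
    Summable fun H : Fin k → MonicPoly F => ‖expansionTerm p r G H‖ := by
  have h0 : (zetaA F r : ℂ) ≠ 0 := by exact_mod_cast zetaA_ne_zero (F := F) hr
  have h1 := (summable_norm_doubleTerm p G hr).prod_symm
  refine Summable.of_nonneg_of_le (fun _ => norm_nonneg _) (fun H => ?_)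
    (h1.prod.mul_left ‖(zetaA F r : ℂ)‖)
  have h2 : expansionTerm p r G H = zetaA F r * ∑' E, doubleTerm p r G E H := by
    rw [tsum_doubleTerm p G hr, mul_div_cancel₀ _ h0]
  rw [h2, norm_mul]
  exact mul_le_mul_of_nonneg_left (norm_tsum_le_tsum_norm (h1.prod_factor H)) (norm_nonneg _)

variable (k) in
theorem weight_add_natCast (s : ℝ) (E : MonicPoly F) :
    weight (k + s) E * absv E.1 ^ k = weight s E := by
  rw [weight, weight, ← Real.rpow_natCast, ← Real.rpow_add (absv_pos _)]
  congr 1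
  ring

theorem tsum_expansionTerm (hk : 1 ≤ k) {s : ℝ} (hs : 1 < (k : ℝ) + s) :
    ((jordan s (gcdFam G) / absv (gcdFam G) ^ s : ℝ) : ℂ) =
      1 / (zetaA F (k + s) : ℂ) * ∑' H, expansionTerm p (k + s) G H := by
  classical
  set D : MonicPoly F := ⟨gcdFam G, gcdFam_monic hk G⟩ with hD
  have hsum : Summable (Function.uncurry (doubleTerm p (k + s) G)) :=
    (summable_norm_doubleTerm p G hs).of_norm
  have h1 : 1 / (zetaA F (k + s) : ℂ) * ∑' H, expansionTerm p (k + s) G H =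
      ∑' H, ∑' E, doubleTerm p (k + s) G E H := by
    simp_rw [tsum_doubleTerm p G hs]
    rw [tsum_div_const, one_div_mul_eq_div]
  have h2 : ∀ E : MonicPoly F, ∑' H, doubleTerm p (k + s) G E H =
      if E ∣ D then ((moebius E.1 * weight s E : ℝ) : ℂ) else 0 := by
    intro E
    rw [(hasSum_doubleTerm p G E).tsum_eq]
    simp_rw [sum_divs_ramanujanSum]
    have h3 : E ∣ D ↔ ∀ i, E.1 ∣ (G i).1 := by
      rw [MonicPoly.dvd_iff, hD, dvd_gcdFam_iff]
    split_ifs with h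
    -- The `k` divisor sums contribute `|E| ^ k`, lowering the exponent of the weight from `k + s`
    -- to `s`.
    · rw [Finset.prod_congr rfl fun i _ => if_pos (h3.1 h i), Finset.prod_const,
        Finset.card_univ, Fintype.card_fin, ← weight_add_natCast k s]
      push_cast
      ring
    · obtain ⟨i, hi⟩ := not_forall.1 (mt h3.2 h)
      rw [Finset.prod_eq_zero (Finset.mem_univ i) (if_neg hi), mul_zero]
  have h4 : jordan s (gcdFam G) / absv (gcdFam G) ^ s = jordan s D.1 * weight s D := by
    rw [weight, Real.rpow_neg (absv_pos _).le, div_eq_mul_inv]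
  rw [h1, Summable.tsum_comm hsum, tsum_congr h2, h4, jordan_mul_weight,
    tsum_eq_sum (s := divs D) fun E hE => if_neg (mt mem_divs.2 hE), Complex.ofReal_sum]
  exact Finset.sum_congr rfl fun E hE => (if_pos (mem_divs.1 hE)).symm

end Expansion

end PolyRamanujan

theorem mainTheorem11 {F : Type*} [Field F] [Finite F] (p : ℕ) [Fact p.Prime]
    [Algebra (ZMod p) F] (k : ℕ) (hk : 1 ≤ k) (G : Fin k → PolyRamanujan.MonicPoly F) :
    (∀ s : ℝ, 1 < (k : ℝ) + s →
      (Summable fun H : Fin k → PolyRamanujan.MonicPoly F =>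
        ‖PolyRamanujan.expansionTerm p ((k : ℝ) + s) G H‖) ∧
      ((PolyRamanujan.jordan s (PolyRamanujan.gcdFam G) /
          PolyRamanujan.absv (PolyRamanujan.gcdFam G) ^ s : ℝ) : ℂ) =
        1 / (PolyRamanujan.zetaA F ((k : ℝ) + s) : ℂ) *
          ∑' H : Fin k → PolyRamanujan.MonicPoly F,
            PolyRamanujan.expansionTerm p ((k : ℝ) + s) G H) ∧
    ((Summable fun H : Fin k → PolyRamanujan.MonicPoly F =>
        ‖PolyRamanujan.expansionTerm p ((k : ℝ) + 1) G H‖) ∧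
      (((PolyRamanujan.totient (PolyRamanujan.gcdFam G) : ℝ) /
          PolyRamanujan.absv (PolyRamanujan.gcdFam G) : ℝ) : ℂ) =
        1 / (PolyRamanujan.zetaA F ((k : ℝ) + 1) : ℂ) *
          ∑' H : Fin k → PolyRamanujan.MonicPoly F,
            PolyRamanujan.expansionTerm p ((k : ℝ) + 1) G H) := by
  have h1 : (1 : ℝ) < k + 1 := by
    have : (1 : ℝ) ≤ k := by exact_mod_cast hk
    linarith
  refine ⟨fun s hs => ⟨PolyRamanujan.summable_norm_expansionTerm p G hs,
    PolyRamanujan.tsum_expansionTerm p G hk hs⟩,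
    PolyRamanujan.summable_norm_expansionTerm p G h1, ?_⟩
  rw [← PolyRamanujan.tsum_expansionTerm p G hk h1, Real.rpow_one,
    PolyRamanujan.totient_eq_jordan p ⟨_, PolyRamanujan.gcdFam_monic hk G⟩]
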